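/- Consider a rank-one cutting-and-stacking construction on the real line: a sequence of columns $C_0, C_1, \dots$, each a finite ordered list of pairwise disjoint intervals of equal length (its levels, of heights $0, 1, 2, \dots$ from the bottom), such that $C_0$ is the unit interval alone and $C_{n+1}$ is obtained from $C_n$ by cutting it into $r_n \ge 2$ subcolumns of equal width, putting any number $s_{n,m} \ge 0$ of new levels (spacers) above the $m$-th subcolumn, $0 \le m < r_n$, and stacking every subcolumn under the one to its right. Let $Y \subseteq \mathbb{R}$ be the union of all levels, with Lebesgue measure, and let $T : Y \to Y$ be the rank-one transformation of the construction, that is, the invertible measurable map, determined up to null sets, that translates every level of every column, except the top one, onto the level directly above it. For $j \ge i$ and $I$ the base (the level of height $0$) of $C_i$, let $D(I,j) \subset \mathbb{N}$ be the set of heights of the levels of $C_j$ that are contained in $I$ (the descendants of $I$). Let $k \ge 1$, let $\alpha_0, \dots, \alpha_{k-1}$ be nonzero integers and let $S := T^{\alpha_0} \times \cdots \times T^{\alpha_{k-1}}$ on $Y^k$ with the product measure $\mu$. Then $S$ is conservative (that is, $A \subseteq \bigcup_{n \ge 1} S^{-n} A$ modulo $\mu$ for every measurable set $A$) if and only if for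 every $i \ge 0$, with $I$ the base of $C_i$, and every $\varepsilon > 0$ there is $j \ge i$ such that for at least $(1-\varepsilon)\,|D(I,j)|^k$ of the $k$-tuples $(a_0, \dots, a_{k-1}) \in D(I,j)^k$ there is a $k$-tuple $(d_0, \dots, d_{k-1}) \in D(I,j)^k$ for which the quotients $$\frac{a_\ell - d_\ell}{\alpha_\ell}, \qquad \ell = 0, \dots, k-1,$$ are all equal to one and the same nonzero integer. -/

import Mathlib

open MeasureTheory

noncomputable section

namespace RankOne

/-- The number of levels of the `n`-th column, when `C₀` has one level and `Cₙ₊₁` is obtained by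
cutting `Cₙ` into `r n` subcolumns and putting `s n k` spacers above the `k`-th subcolumn. -/
def columnHeight (r : ℕ → ℕ) (s : ℕ → ℕ → ℕ) : ℕ → ℕ
  | 0 => 1
  | n + 1 => ∑ k ∈ Finset.range (r n), (columnHeight r s n + s n k)

/-- The height in `Cₙ₊₁` at which the `k`-th copy of `Cₙ` starts. -/
def copyHeight (r : ℕ → ℕ) (s : ℕ → ℕ → ℕ) (n k : ℕ) : ℕ :=
  ∑ m ∈ Finset.range k, (columnHeight r s n + s n m)

/-- The common length of the levels of the `n`-th column. -/
def levelWidth (r : ℕ → ℕ) (n : ℕ) : ℝ :=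
  ∏ m ∈ Finset.range n, (r m : ℝ)⁻¹

/-- A rank-one cutting-and-stacking construction on the real line. The level of height `a`
(counted from `0`) of the column `Cₙ` is the interval
`[left n a, left n a + levelWidth r n)`, for `a < columnHeight r s n`.
The values of `left n a` for `a ≥ columnHeight r s n` and of `s n k` for `k ≥ r n` play no role. -/
structure CuttingAndStacking where
  /-- the number of subcolumns into which `Cₙ` is cut -/
  r : ℕ → ℕ
  /-- the number of spacers above the `k`-th subcolumn of `Cₙ` -/
  s : ℕ → ℕ → ℕ
  /-- the left end point of the level of height `a` in `Cₙ` -/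
  left : ℕ → ℕ → ℝ
  two_le_r : ∀ n, 2 ≤ r n
  /-- `C₀` is the unit interval -/
  left_zero : left 0 0 = 0
  /-- the levels of the `k`-th copy of `Cₙ` inside `Cₙ₊₁` are the `k`-th pieces, from left to
  right, of the levels of `Cₙ`; the other levels of `Cₙ₊₁` are spacers -/
  left_succ : ∀ n k a, k < r n → a < columnHeight r s n →
    left (n + 1) (copyHeight r s n k + a) = left n a + k * levelWidth r (n + 1)
  /-- the levels of a column are pairwise disjoint (so the spacers are new) -/
  disjoint_levels : ∀ n a b, a < columnHeight r s n → b < columnHeight r s n → a ≠ b →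
    Disjoint (Set.Ico (left n a) (left n a + levelWidth r n))
      (Set.Ico (left n b) (left n b + levelWidth r n))

namespace CuttingAndStacking

variable (c : CuttingAndStacking)

/-- The number `hₙ` of levels of `Cₙ`. -/
def height (n : ℕ) : ℕ := columnHeight c.r c.s n

/-- The level of height `a` of the column `Cₙ`. -/
def level (n a : ℕ) : Set ℝ :=
  Set.Ico (c.left n a) (c.left n a + levelWidth c.r n)

/-- The space on which the transformation acts: the union of all levels of all columns. -/
def space : Set ℝ := ⋃ n : ℕ, ⋃ a : ℕ, ⋃ _ : a < c.height n, c.level n a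

/-- Lebesgue measure on the space. -/
def measure : Measure c.space := Measure.comap Subtype.val volume

/-- `T` is the rank-one transformation of the construction: up to null sets, it extends all the
column maps, that is, it translates each non-top level of each column onto the level above it.
(An everywhere defined bijection can do so only up to null sets: the left end point of the base
of `C₀` is in the base of every column, so that no column map takes this value.) -/
def IsRankOneMap (T : c.space ≃ᵐ c.space) : Prop :=
  ∀ n a, a + 1 < c.height n → ∀ᵐ x : c.space ∂c.measure,
    (x : ℝ) ∈ c.level n a → (T x : ℝ) = (x : ℝ) + (c.left n (a + 1) - c.left n a)

open Classical in
/-- `D(I, n)`, where `I` is the level of height `b` of the column `Cₘ` and `m ≤ n`: the heights of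
those levels of `Cₙ` that are contained in `I`. -/
def descendants (m b n : ℕ) : Finset ℕ :=
  (Finset.range (c.height n)).filter fun a => c.level n a ⊆ c.level m b

/-- The `k`-tuples of descendants in `Cⱼ` of the base of `Cᵢ`. -/
def descendantTuples (k i j : ℕ) : Finset (Fin k → ℕ) :=
  Fintype.piFinset fun _ => c.descendants i 0 j

/-- The tuples of descendants `a` that have a complementary tuple of descendants `d`: all the
quotients `(a_ℓ - d_ℓ) / α_ℓ` are one and the same nonzero integer. -/
def complementedTuples {k : ℕ} (α : Fin k → ℤ) (i j : ℕ) : Set (Fin k → ℕ) :=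
  {a | a ∈ c.descendantTuples k i j ∧ ∃ d ∈ c.descendantTuples k i j, ∃ n : ℤ, n ≠ 0 ∧
    ∀ l, ((a l : ℚ) - (d l : ℚ)) / (α l : ℚ) = (n : ℚ)}

end CuttingAndStacking

/-- The product transformation `T ^ α₀ × ⋯ × T ^ αₖ₋₁`. -/
def productOfPowers {Y : Type*} [MeasurableSpace Y] (T : Y ≃ᵐ Y) {k : ℕ} (α : Fin k → ℤ) :
    (Fin k → Y) → (Fin k → Y) :=
  fun x l => ((T.toEquiv : Equiv.Perm Y) ^ α l) (x l)

end RankOne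

end

namespace RankOne

/-! The descendants in `C_j` of the base of `C_i` cut the base box of `Y ^ k` into boxes of equal
measure, indexed by tuples. If `a = d + n • α`, then `S ^ n` carries the box of `d` onto the box of
`a` up to a null set. The combinatorial condition thus says that most small boxes are images of
others under a nontrivial power of `S`.

If the condition holds, a wandering set of positive measure would nearly fill some box
(`exists_box_measure_inter_gt`), which may be moved to the base box since powers of `T` commute with
`S`. Two boxes that are each more than half filled cannot be complementary. By the injection in
`ncard_complementedTuples_le`, many boxes are then at most half filled, against the density.

Conversely, conservativity makes almost every point of the base box return, and all but a small part
does so within a time `M`. For large `j` few tuples are so close to the ends of `C_j` that `M` steps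
can leave the column (`card_filter_edge_mul_le`). For the other tuples `S ^ m` with `m ≤ M` permutes
boxes, so a return exhibits a complement. -/

lemma levelWidth_succ (r : ℕ → ℕ) (n : ℕ) :
    levelWidth r (n + 1) = levelWidth r n * (r n : ℝ)⁻¹ := by
  rw [levelWidth, levelWidth, Finset.prod_range_succ]

lemma copyHeight_add_lt {r : ℕ → ℕ} {s : ℕ → ℕ → ℕ} {n k a : ℕ} (hk : k < r n)
    (ha : a < columnHeight r s n) : copyHeight r s n k + a < columnHeight r s (n + 1) := by
  have h : copyHeight r s n (k + 1) ≤ columnHeight r s (n + 1) := by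
    simp only [copyHeight, columnHeight]
    exact Finset.sum_le_sum_of_subset (Finset.range_subset_range.2 hk)
  have h2 : copyHeight r s n (k + 1) = copyHeight r s n k + (columnHeight r s n + s n k) := by
    simp only [copyHeight, Finset.sum_range_succ]
  omega

/-! ### Widths, nesting and counting of levels. -/

namespace CuttingAndStacking

variable (c : CuttingAndStacking)

lemma levelWidth_pos (n : ℕ) : 0 < levelWidth c.r n :=
  Finset.prod_pos fun m _ => inv_pos.2 (by have := c.two_le_r m; positivity)

lemma r_mul_levelWidth_succ (n : ℕ) : (c.r n : ℝ) * levelWidth c.r (n + 1) = levelWidth c.r n := by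
  have : (c.r n : ℝ) ≠ 0 := by have := c.two_le_r n; positivity
  rw [levelWidth_succ]; field_simp

lemma levelWidth_le (n : ℕ) : levelWidth c.r n ≤ (1 / 2 : ℝ) ^ n := by
  induction n with
  | zero => simp [levelWidth]
  | succ n ih =>
    rw [levelWidth_succ, pow_succ]
    have h : (c.r n : ℝ)⁻¹ ≤ 1 / 2 := by
      rw [one_div]
      exact inv_anti₀ (by norm_num) (by exact_mod_cast c.two_le_r n)
    exact mul_le_mul ih h (by positivity) (by positivity)

lemma tendsto_levelWidth : Filter.Tendsto (levelWidth c.r) Filter.atTop (nhds 0) :=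
  squeeze_zero (fun n => (c.levelWidth_pos n).le) c.levelWidth_le
    (tendsto_pow_atTop_nhds_zero_of_lt_one (by norm_num) (by norm_num))

lemma level_child_subset {n k a : ℕ} (hk : k < c.r n) (ha : a < c.height n) :
    c.level (n + 1) (copyHeight c.r c.s n k + a) ⊆ c.level n a := by
  have h := c.r_mul_levelWidth_succ n
  have hw := c.levelWidth_pos (n + 1)
  have hk' : (k : ℝ) + 1 ≤ c.r n := by exact_mod_cast hk
  rw [level, level, c.left_succ n k a hk ha, ← h]
  apply Set.Ico_subset_Ico
  · nlinarith
  · nlinarith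

lemma exists_child_mem {n a : ℕ} (ha : a < c.height n) {x : ℝ} (hx : x ∈ c.level n a) :
    ∃ k < c.r n, x ∈ c.level (n + 1) (copyHeight c.r c.s n k + a) := by
  have h := c.r_mul_levelWidth_succ n
  have hw := c.levelWidth_pos (n + 1)
  obtain ⟨h1, h2⟩ := hx
  -- The offset of `x` in units of the narrower width; its integer part is the index of the
  -- subcolumn.
  set y := (x - c.left n a) / levelWidth c.r (n + 1) with hy
  have hy0 : 0 ≤ y := div_nonneg (by linarith) hw.le
  have hxy : x = c.left n a + y * levelWidth c.r (n + 1) := by rw [hy]; field_simp; ring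
  have hyr : y < c.r n := by
    rw [hy, div_lt_iff₀ hw]; linarith
  have hk : ⌊y⌋₊ < c.r n := (Nat.floor_lt hy0).2 hyr
  refine ⟨⌊y⌋₊, hk, ?_⟩
  have f1 := Nat.floor_le hy0
  have f2 := Nat.lt_floor_add_one y
  rw [level, c.left_succ n _ a hk ha]
  constructor <;> nlinarith

lemma eq_of_mem_level {n a b : ℕ} (ha : a < c.height n) (hb : b < c.height n) {x : ℝ}
    (hxa : x ∈ c.level n a) (hxb : x ∈ c.level n b) : a = b := by
  by_contra h
  exact Set.disjoint_left.1 (c.disjoint_levels n a b ha hb h) hxa hxb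

lemma mem_descendants {i b j a : ℕ} :
    a ∈ c.descendants i b j ↔ a < c.height j ∧ c.level j a ⊆ c.level i b := by
  simp [descendants]

lemma exists_descendant_mem {i b j : ℕ} (hij : i ≤ j) (hb : b < c.height i) {x : ℝ}
    (hx : x ∈ c.level i b) : ∃ a ∈ c.descendants i b j, x ∈ c.level j a := by
  induction j, hij using Nat.le_induction with
  | base => exact ⟨b, c.mem_descendants.2 ⟨hb, subset_rfl⟩, hx⟩
  | succ j _ ih =>
    obtain ⟨a, ha, hxa⟩ := ih
    rw [mem_descendants] at ha
    obtain ⟨k, hk, hxk⟩ := c.exists_child_mem ha.1 hxa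
    exact ⟨_, c.mem_descendants.2 ⟨copyHeight_add_lt hk ha.1,
      (c.level_child_subset hk ha.1).trans ha.2⟩, hxk⟩

/-- Levels of different columns are nested or disjoint, so one common point forces containment. -/
lemma mem_descendants_of_mem {i b j a : ℕ} (hij : i ≤ j) (hb : b < c.height i)
    (ha : a < c.height j) {x : ℝ} (hxa : x ∈ c.level j a) (hxb : x ∈ c.level i b) :
    a ∈ c.descendants i b j := by
  obtain ⟨a', ha', hx⟩ := c.exists_descendant_mem hij hb hxb
  rwa [c.eq_of_mem_level ha (c.mem_descendants.1 ha').1 hxa hx]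

lemma height_pos (n : ℕ) : 0 < c.height n := by
  induction n with
  | zero => simp [height, columnHeight]
  | succ n ih =>
    have := c.two_le_r n
    exact (Nat.zero_le _).trans_lt (copyHeight_add_lt (k := 0) (by omega : 0 < c.r n) ih)

lemma iUnion_descendants {i b j : ℕ} (hij : i ≤ j) (hb : b < c.height i) :
    ⋃ a ∈ c.descendants i b j, c.level j a = c.level i b := by
  ext x
  simp only [Set.mem_iUnion, exists_prop]
  exact ⟨fun ⟨a, ha, hx⟩ => (c.mem_descendants.1 ha).2 hx, c.exists_descendant_mem hij hb⟩

lemma volume_level (n a : ℕ) : volume (c.level n a) = ENNReal.ofReal (levelWidth c.r n) := by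
  simp [level]

lemma measurableSet_level (n a : ℕ) : MeasurableSet (c.level n a) := measurableSet_Ico

/-- Counting by measure: the descendants tile the level. -/
lemma card_descendants_mul {i b j : ℕ} (hij : i ≤ j) (hb : b < c.height i) :
    ((c.descendants i b j).card : ℝ) * levelWidth c.r j = levelWidth c.r i := by
  have h := congrArg volume.real (c.iUnion_descendants hij hb)
  rw [measureReal_biUnion_finset (hm := fun a _ => c.measurableSet_level j a)
    (h := fun a _ => by simp [volume_level])] at h
  · simpa [Measure.real, volume_level, (c.levelWidth_pos _).le] using h
  · intro a ha a' ha' hne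
    exact c.disjoint_levels j a a' (c.mem_descendants.1 ha).1 (c.mem_descendants.1 ha').1 hne

/-! ### The space, its measure, and piecewise translations. -/

lemma level_subset_space {n a : ℕ} (ha : a < c.height n) : c.level n a ⊆ c.space :=
  fun _ hx => Set.mem_iUnion.2 ⟨n, Set.mem_iUnion₂.2 ⟨a, ha, hx⟩⟩

lemma measurableSet_space : MeasurableSet c.space :=
  .iUnion fun _ => .iUnion fun _ => .iUnion fun _ => measurableSet_Ico

lemma exists_level_mem_succ {n : ℕ} {x : ℝ} (h : ∃ a < c.height n, x ∈ c.level n a) :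
    ∃ a < c.height (n + 1), x ∈ c.level (n + 1) a := by
  obtain ⟨a, ha, hx⟩ := h
  obtain ⟨k, hk, hxk⟩ := c.exists_child_mem ha hx
  exact ⟨_, copyHeight_add_lt hk ha, hxk⟩

lemma exists_forall_ge_level_mem (x : c.space) :
    ∃ N, ∀ n ≥ N, ∃ a < c.height n, (x : ℝ) ∈ c.level n a := by
  obtain ⟨N, hN⟩ := Set.mem_iUnion.1 x.2
  obtain ⟨a, ha, hx⟩ := Set.mem_iUnion₂.1 hN
  refine ⟨N, fun n hn => ?_⟩
  induction n, hn using Nat.le_induction with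
  | base => exact ⟨a, ha, hx⟩
  | succ n _ ih => exact c.exists_level_mem_succ ih

/-- The level of height `a` of the column `Cₙ`, as a subset of the space. -/
def slice (n a : ℕ) : Set c.space := Subtype.val ⁻¹' c.level n a

lemma measurableSet_slice (n a : ℕ) : MeasurableSet (c.slice n a) :=
  measurable_subtype_coe measurableSet_Ico

lemma measure_apply (A : Set c.space) : c.measure A = volume (Subtype.val '' A : Set ℝ) :=
  (MeasurableEmbedding.subtype_coe c.measurableSet_space).comap_apply _ _

lemma measure_slice {n a : ℕ} (ha : a < c.height n) :
    c.measure (c.slice n a) = ENNReal.ofReal (levelWidth c.r n) := by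
  rw [measure_apply, slice, Subtype.image_preimage_coe,
    Set.inter_eq_right.2 (c.level_subset_space ha), volume_level]

instance : SigmaFinite c.measure := by
  refine SigmaFinite.of_map _ measurable_subtype_coe.aemeasurable ?_
  rw [measure, (MeasurableEmbedding.subtype_coe c.measurableSet_space).map_comap]
  infer_instance

lemma measure_image_eq_of_translation {f : c.space → c.space} {t : ℝ} {C : Set c.space}
    (h : ∀ x ∈ C, (f x : ℝ) = x + t) : c.measure (f '' C) = c.measure C := by
  have : (Subtype.val '' (f '' C) : Set ℝ) = (fun y => y + t) '' (Subtype.val '' C) := by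
    rw [Set.image_image, Set.image_image]
    exact Set.image_congr h
  rw [measure_apply, measure_apply, this, Set.image_add_right, measure_preimage_add_right]

lemma measurableSet_image_of_translation {f : c.space → c.space} {t : ℝ} {C : Set c.space}
    (hC : MeasurableSet C) (h : ∀ x ∈ C, (f x : ℝ) = x + t) : MeasurableSet (f '' C) := by
  have e := MeasurableEmbedding.subtype_coe c.measurableSet_space
  have : (Subtype.val '' (f '' C) : Set ℝ) = (fun y => y + t) '' (Subtype.val '' C) := by
    rw [Set.image_image, Set.image_image]
    exact Set.image_congr h
  rw [← e.measurableSet_image, this, Set.image_add_right]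
  exact (measurable_add_const _) (e.measurableSet_image.2 hC)

/-- An injective map that is piecewise a translation does not increase measures of preimages. -/
lemma measure_preimage_le_of_translations {f : c.space → c.space} (hf : Measurable f)
    (hinj : Function.Injective f) (t : ℕ → ℝ)
    (h : ∀ᵐ x ∂c.measure, ∃ i, (f x : ℝ) = x + t i) {B : Set c.space} (hB : MeasurableSet B) :
    c.measure (f ⁻¹' B) ≤ c.measure B := by
  -- The preimage is split into disjoint pieces on each of which `f` is a single translation; by
  -- injectivity their images are disjoint parts of `B`.
  set E : ℕ → Set c.space := fun i => {x | (f x : ℝ) = x + t i} with hE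
  have hEm : ∀ i, MeasurableSet (E i) := fun i =>
    measurableSet_eq_fun hf.subtype_val (measurable_subtype_coe.add_const _)
  set C : ℕ → Set c.space := fun i => f ⁻¹' B ∩ disjointed E i with hC
  have hCm : ∀ i, MeasurableSet (C i) := fun i => (hf hB).inter (MeasurableSet.disjointed hEm i)
  have hCt : ∀ i, ∀ x ∈ C i, (f x : ℝ) = x + t i := fun i x hx => disjointed_subset E i hx.2
  have hd : Pairwise (Function.onFun Disjoint C) := fun i j hij =>
    (disjoint_disjointed E hij).mono Set.inter_subset_right Set.inter_subset_right
  calc c.measure (f ⁻¹' B) ≤ c.measure (⋃ i, C i) := by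
        apply measure_mono_ae
        filter_upwards [h] with x hx hxB
        have : x ∈ ⋃ i, disjointed E i := by rw [iUnion_disjointed]; exact Set.mem_iUnion.2 hx
        obtain ⟨i, hi⟩ := Set.mem_iUnion.1 this
        exact Set.mem_iUnion.2 ⟨i, hxB, hi⟩
    _ = ∑' i, c.measure (C i) := measure_iUnion hd hCm
    _ = ∑' i, c.measure (f '' C i) := by
        congr 1; ext1 i; exact (c.measure_image_eq_of_translation (hCt i)).symm
    _ = c.measure (⋃ i, f '' C i) := (measure_iUnion
        (fun i j hij => Set.disjoint_image_of_injective hinj (hd hij))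
        fun i => c.measurableSet_image_of_translation (hCm i) (hCt i)).symm
    _ ≤ c.measure B := by
        apply measure_mono
        rintro _ hy
        obtain ⟨i, x, hx, rfl⟩ := Set.mem_iUnion.1 hy
        exact hx.1

/-- Almost every point leaves any prescribed sequence of levels. -/
lemma ae_exists_mem_slice_ne (b : ℕ → ℕ) (hb : ∀ n, b n < c.height n) :
    ∀ᵐ x ∂c.measure, ∃ n a, a < c.height n ∧ a ≠ b n ∧ x ∈ c.slice n a := by
  -- Points that follow `b` from `N` on lie in levels whose widths tend to zero.
  have key : ∀ N, c.measure (⋂ n ≥ N, c.slice n (b n)) = 0 := fun N => by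
    have hlim : Filter.Tendsto (fun n => ENNReal.ofReal (levelWidth c.r n)) Filter.atTop
        (nhds 0) := by simpa using ENNReal.tendsto_ofReal c.tendsto_levelWidth
    refine le_antisymm (ge_of_tendsto hlim ?_) zero_le
    filter_upwards [Filter.eventually_ge_atTop N] with n hn
    rw [← c.measure_slice (hb n)]
    exact measure_mono (Set.biInter_subset_of_mem hn)
  rw [ae_iff]
  refine measure_mono_null (fun x hx => ?_) (measure_iUnion_null key)
  obtain ⟨N, hN⟩ := c.exists_forall_ge_level_mem x
  refine Set.mem_iUnion.2 ⟨N, Set.mem_iInter₂.2 fun n hn => ?_⟩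
  obtain ⟨a, ha, hxa⟩ := hN n hn
  by_cases hab : a = b n
  · exact hab ▸ hxa
  · exact absurd ⟨n, a, ha, hab, hxa⟩ hx

/-! ### The rank-one map preserves the measure and moves levels within columns. -/

variable {c} {T : c.space ≃ᵐ c.space}

lemma IsRankOneMap.ae_apply (hT : c.IsRankOneMap T) : ∀ᵐ x ∂c.measure, ∀ n a,
    a + 1 < c.height n → x ∈ c.slice n a →
      (T x : ℝ) = (x : ℝ) + (c.left n (a + 1) - c.left n a) := by
  rw [ae_all_iff]; intro n
  rw [ae_all_iff]; intro a
  by_cases h : a + 1 < c.height n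
  · filter_upwards [hT n a h] with x hx _ hxa using hx hxa
  · exact Filter.Eventually.of_forall fun x hx => absurd hx h

lemma IsRankOneMap.ae_symm_apply (hT : c.IsRankOneMap T) : ∀ᵐ x ∂c.measure, ∀ n a,
    a + 1 < c.height n → x ∈ c.slice n (a + 1) →
      (T.symm x : ℝ) = (x : ℝ) + (c.left n a - c.left n (a + 1)) := by
  rw [ae_all_iff]; intro n
  rw [ae_all_iff]; intro a
  by_cases h : a + 1 < c.height n
  swap
  · exact Filter.Eventually.of_forall fun x hx => absurd hx h
  set t := c.left n (a + 1) - c.left n a with ht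
  -- points of the level below which the map does not translate
  set Z : Set c.space := {x | ¬ ((x : ℝ) ∈ c.level n a → (T x : ℝ) = (x : ℝ) + t)} with hZ
  have hZ0 : volume (Subtype.val '' Z : Set ℝ) = 0 := by
    rw [← measure_apply]; exact ae_iff.1 (hT n a h)
  -- That `T` preserves null sets is not yet available; translation invariance of Lebesgue measure
  -- on the line replaces it.
  have h0 : c.measure (Subtype.val ⁻¹' ((fun y : ℝ => y + t) '' (Subtype.val '' Z))) = 0 := by
    rw [measure_apply]
    refine measure_mono_null (Set.image_preimage_subset _ _) ?_
    rw [Set.image_add_right, measure_preimage_add_right, hZ0]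
  filter_upwards [measure_eq_zero_iff_ae_notMem.1 h0] with x hx _ hxa
  have hxt : (x : ℝ) - t ∈ c.level n a := by
    have : (x : ℝ) ∈ c.level n (a + 1) := hxa
    simp only [level, Set.mem_Ico, ht] at this ⊢
    constructor <;> linarith [this.1, this.2]
  set y : c.space := ⟨(x : ℝ) - t, c.level_subset_space (by omega) hxt⟩ with hy
  have hyZ : y ∉ Z := fun hyZ => hx ⟨y, ⟨y, hyZ, rfl⟩, by simp [hy]⟩
  have hTy : (T y : ℝ) = (y : ℝ) + t := by
    by_contra hne
    exact hyZ fun hcon => hne (hcon hxt)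
  have : T y = x := Subtype.ext (by rw [hTy]; simp [hy])
  rw [← this, MeasurableEquiv.symm_apply_apply, hTy]
  linarith

/-- Almost every point is eventually outside the top level, and outside the base, of some column. So
`T` and its inverse are both piecewise translations; one inequality for each gives equality. -/
lemma IsRankOneMap.measurePreserving (hT : c.IsRankOneMap T) :
    MeasurePreserving T c.measure c.measure := by
  have h1 : ∀ B, MeasurableSet B → c.measure (T ⁻¹' B) ≤ c.measure B := fun B hB => by
    refine c.measure_preimage_le_of_translations T.measurable T.injective
      (fun i => c.left i.unpair.1 (i.unpair.2 + 1) - c.left i.unpair.1 i.unpair.2) ?_ hB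
    filter_upwards [hT.ae_apply, c.ae_exists_mem_slice_ne (fun n => c.height n - 1)
      fun n => Nat.sub_lt (c.height_pos n) one_pos] with x hx ⟨n, a, ha, hne, hxa⟩
    exact ⟨Nat.pair n a, by simpa using hx n a (by omega) hxa⟩
  have h2 : ∀ B, MeasurableSet B → c.measure (T.symm ⁻¹' B) ≤ c.measure B := fun B hB => by
    refine c.measure_preimage_le_of_translations T.symm.measurable T.symm.injective
      (fun i => c.left i.unpair.1 i.unpair.2 - c.left i.unpair.1 (i.unpair.2 + 1)) ?_ hB
    filter_upwards [hT.ae_symm_apply, c.ae_exists_mem_slice_ne (fun _ => 0) c.height_pos]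
      with x hx ⟨n, a, ha, hne, hxa⟩
    obtain ⟨a, rfl⟩ := Nat.exists_eq_succ_of_ne_zero hne
    exact ⟨Nat.pair n a, by simpa using hx n a ha hxa⟩
  refine ⟨T.measurable, Measure.ext fun B hB => ?_⟩
  rw [Measure.map_apply T.measurable hB]
  refine le_antisymm (h1 B hB) ?_
  simpa [← Set.preimage_comp] using h2 _ (T.measurable hB)

lemma measurePreserving_zpow (hT : MeasurePreserving T c.measure c.measure) (z : ℤ) :
    MeasurePreserving ⇑((T.toEquiv : Equiv.Perm c.space) ^ z) c.measure c.measure := by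
  cases z with
  | ofNat n =>
    simp only [Int.ofNat_eq_natCast, zpow_natCast, Equiv.Perm.coe_pow]
    exact hT.iterate n
  | negSucc n =>
    rw [zpow_negSucc, ← inv_pow, Equiv.Perm.coe_pow]
    exact (hT.symm T).iterate (n + 1)

/-- One-step translation fails on a null set; its preimages under the powers of `T` are null too,
which allows iteration. -/
lemma IsRankOneMap.ae_zpow_mem_slice_of_le (hT : c.IsRankOneMap T) : ∀ᵐ x ∂c.measure, ∀ n a m : ℕ,
    a + m < c.height n → x ∈ c.slice n a →
      ((T.toEquiv : Equiv.Perm c.space) ^ (m : ℤ)) x ∈ c.slice n (a + m) := by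
  have : ∀ᵐ x ∂c.measure, ∀ m : ℕ, ∀ n a, a + 1 < c.height n →
      ((T.toEquiv : Equiv.Perm c.space) ^ (m : ℤ)) x ∈ c.slice n a →
      T (((T.toEquiv : Equiv.Perm c.space) ^ (m : ℤ)) x) ∈ c.slice n (a + 1) := by
    rw [ae_all_iff]; intro m
    refine (measurePreserving_zpow hT.measurePreserving m).quasiMeasurePreserving.ae
      (p := fun y => ∀ n a, a + 1 < c.height n → y ∈ c.slice n a → T y ∈ c.slice n (a + 1)) ?_
    filter_upwards [hT.ae_apply] with x hx n a ha hxa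
    have h1 := hx n a ha hxa
    have h2 : (x : ℝ) ∈ c.level n a := hxa
    simp only [slice, level, Set.mem_preimage, Set.mem_Ico] at h2 ⊢
    constructor <;> linarith [h2.1, h2.2]
  filter_upwards [this] with x hx n a m ham hxa
  induction m with
  | zero => simpa using hxa
  | succ m ih =>
    have h := hx m n (a + m) (by omega) (ih (by omega))
    rw [Nat.cast_succ, add_comm (m : ℤ), zpow_add, zpow_one]
    exact h

/-- The forward inclusion is an equality because both sets have the same finite measure. This gives
control of negative powers. -/
lemma IsRankOneMap.slice_ae_eq (hT : c.IsRankOneMap T) {n a m : ℕ} (h : a + m < c.height n) :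
    (((T.toEquiv : Equiv.Perm c.space) ^ (m : ℤ)) ⁻¹' c.slice n (a + m) : Set c.space)
      =ᵐ[c.measure] c.slice n a := by
  have mp := measurePreserving_zpow hT.measurePreserving m
  refine (ae_eq_of_ae_subset_of_measure_ge ?_ ?_
    (c.measurableSet_slice n a).nullMeasurableSet ?_).symm
  · filter_upwards [hT.ae_zpow_mem_slice_of_le] with x hx hxa using hx n a m h hxa
  · rw [mp.measure_preimage (c.measurableSet_slice _ _).nullMeasurableSet, c.measure_slice h,
      c.measure_slice (by omega)]
  · rw [mp.measure_preimage (c.measurableSet_slice _ _).nullMeasurableSet, c.measure_slice h]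
    exact ENNReal.ofReal_ne_top

/-- Powers of the rank-one map permute the levels of a column as long as they stay inside it. -/
lemma IsRankOneMap.ae_zpow_mem_slice (hT : c.IsRankOneMap T) : ∀ᵐ x ∂c.measure, ∀ (n a a' : ℕ),
    a < c.height n → a' < c.height n → x ∈ c.slice n a →
      ((T.toEquiv : Equiv.Perm c.space) ^ ((a' : ℤ) - a)) x ∈ c.slice n a' := by
  have back : ∀ᵐ x ∂c.measure, ∀ n a m : ℕ, a + m < c.height n → x ∈ c.slice n (a + m) →
      ((T.toEquiv : Equiv.Perm c.space) ^ (-(m : ℤ))) x ∈ c.slice n a := by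
    rw [ae_all_iff]; intro n
    rw [ae_all_iff]; intro a
    rw [ae_all_iff]; intro m
    by_cases h : a + m < c.height n
    swap
    · exact Filter.Eventually.of_forall fun x hx => absurd hx h
    have h1 := (measurePreserving_zpow hT.measurePreserving (-(m : ℤ))).quasiMeasurePreserving.ae
      (hT.slice_ae_eq h).mem_iff
    filter_upwards [h1] with x hx _ hxa
    rw [← hx, Set.mem_preimage, ← Equiv.Perm.mul_apply, ← zpow_add]
    simpa using hxa
  filter_upwards [back, hT.ae_zpow_mem_slice_of_le] with x hb hf n a a' ha ha' hxa
  rcases le_total a a' with h | h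
  · obtain ⟨m, rfl⟩ := Nat.exists_eq_add_of_le h
    simpa using hf n a m ha' hxa
  · obtain ⟨m, rfl⟩ := Nat.exists_eq_add_of_le h
    simpa using hb n a' m ha hxa

end CuttingAndStacking

/-! ### Algebra of products of powers. -/

section Powers

variable {Y : Type*} [MeasurableSpace Y] (T : Y ≃ᵐ Y) {k : ℕ}

lemma productOfPowers_add (a b : Fin k → ℤ) (x : Fin k → Y) :
    productOfPowers T (a + b) x = productOfPowers T a (productOfPowers T b x) := by
  funext l
  simp [productOfPowers, zpow_add]

lemma productOfPowers_zero (x : Fin k → Y) : productOfPowers T (0 : Fin k → ℤ) x = x := by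
  funext l
  simp [productOfPowers]

lemma productOfPowers_comm (a b : Fin k → ℤ) (x : Fin k → Y) :
    productOfPowers T a (productOfPowers T b x) = productOfPowers T b (productOfPowers T a x) := by
  rw [← productOfPowers_add, ← productOfPowers_add, add_comm]

lemma iterate_productOfPowers (a : Fin k → ℤ) (m : ℕ) (x : Fin k → Y) :
    (productOfPowers T a)^[m] x = productOfPowers T ((m : ℤ) • a) x := by
  induction m with
  | zero => simp [productOfPowers_zero]
  | succ m ih =>
    rw [Function.iterate_succ_apply', ih, ← productOfPowers_add]
    congr 1
    push_cast
    rw [add_smul, one_smul, add_comm]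

end Powers

/-! ### Boxes in the product space and a density theorem for them. -/

namespace CuttingAndStacking

variable (c : CuttingAndStacking)

/-- The box in `Y ^ k` whose sides are the levels of `Cₙ` of heights `a₀, …, aₖ₋₁`. -/
def box {k : ℕ} (n : ℕ) (a : Fin k → ℕ) : Set (Fin k → c.space) :=
  Set.pi Set.univ fun l => c.slice n (a l)

/-- The product measure on `Y ^ k`. -/
noncomputable abbrev productMeasure (k : ℕ) : Measure (Fin k → c.space) := Measure.pi fun _ : Fin k => c.measure

variable {k : ℕ}

lemma mem_box {n : ℕ} {a : Fin k → ℕ} {x : Fin k → c.space} :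
    x ∈ c.box n a ↔ ∀ l, (x l : ℝ) ∈ c.level n (a l) := by
  simp [box, slice]

lemma measurableSet_box (n : ℕ) (a : Fin k → ℕ) : MeasurableSet (c.box n a) :=
  MeasurableSet.univ_pi fun _ => c.measurableSet_slice _ _

lemma measure_box {n : ℕ} {a : Fin k → ℕ} (ha : ∀ l, a l < c.height n) :
    c.productMeasure k (c.box n a) = ENNReal.ofReal (levelWidth c.r n ^ k) := by
  rw [box, Measure.pi_pi]
  simp [c.measure_slice (ha _), ENNReal.ofReal_pow (c.levelWidth_pos n).le]

lemma measureReal_box {n : ℕ} {a : Fin k → ℕ} (ha : ∀ l, a l < c.height n) :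
    (c.productMeasure k).real (c.box n a) = levelWidth c.r n ^ k := by
  rw [Measure.real, c.measure_box ha, ENNReal.toReal_ofReal (pow_pos (c.levelWidth_pos n) k).le]

lemma eq_of_mem_box {n : ℕ} {a b : Fin k → ℕ} (ha : ∀ l, a l < c.height n)
    (hb : ∀ l, b l < c.height n) {x : Fin k → c.space} (hxa : x ∈ c.box n a)
    (hxb : x ∈ c.box n b) : a = b :=
  funext fun l => c.eq_of_mem_level (ha l) (hb l) (c.mem_box.1 hxa l) (c.mem_box.1 hxb l)

lemma mem_descendantTuples {i j : ℕ} {a : Fin k → ℕ} :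
    a ∈ c.descendantTuples k i j ↔ ∀ l, a l ∈ c.descendants i 0 j := by
  simp [descendantTuples]

lemma lt_height_of_mem_descendantTuples {i j : ℕ} {a : Fin k → ℕ}
    (ha : a ∈ c.descendantTuples k i j) (l : Fin k) : a l < c.height j :=
  (c.mem_descendants.1 (c.mem_descendantTuples.1 ha l)).1

lemma box_subset_of_mem_descendantTuples {i j : ℕ} {a : Fin k → ℕ}
    (ha : a ∈ c.descendantTuples k i j) : c.box j a ⊆ c.box i (0 : Fin k → ℕ) := fun _ hx =>
  c.mem_box.2 fun l => (c.mem_descendants.1 (c.mem_descendantTuples.1 ha l)).2 (c.mem_box.1 hx l)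

lemma card_descendantTuples (i j : ℕ) :
    (c.descendantTuples k i j).card = (c.descendants i 0 j).card ^ k := by
  simp [descendantTuples]

lemma box_zero_subset_iUnion {i j : ℕ} (hij : i ≤ j) :
    c.box i (0 : Fin k → ℕ) ⊆ ⋃ a ∈ c.descendantTuples k i j, c.box j a := fun x hx => by
  choose a ha hxa using fun l => c.exists_descendant_mem hij (c.height_pos i) (c.mem_box.1 hx l)
  exact Set.mem_iUnion₂.2 ⟨a, c.mem_descendantTuples.2 ha, c.mem_box.2 hxa⟩

lemma exists_forall_ge_mem_box (x : Fin k → c.space) :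
    ∃ N, ∀ n ≥ N, ∃ a : Fin k → ℕ, (∀ l, a l < c.height n) ∧ x ∈ c.box n a := by
  choose N hN using fun l => c.exists_forall_ge_level_mem (x l)
  refine ⟨Finset.univ.sup N, fun n hn => ?_⟩
  choose a ha hxa using fun l => hN l n ((Finset.le_sup (Finset.mem_univ l)).trans hn)
  exact ⟨a, ha, c.mem_box.2 hxa⟩

lemma exists_box_subset {n : ℕ} {a : Fin k → ℕ} (ha : ∀ l, a l < c.height n)
    {x : Fin k → c.space} (hx : x ∈ c.box n a) :
    ∃ a' : Fin k → ℕ, (∀ l, a' l < c.height (n + 1)) ∧ x ∈ c.box (n + 1) a' ∧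
      c.box (n + 1) a' ⊆ c.box n a := by
  choose a' ha' hxa using fun l => c.exists_descendant_mem n.le_succ (ha l) (c.mem_box.1 hx l)
  simp only [mem_descendants] at ha'
  exact ⟨a', fun l => (ha' l).1, c.mem_box.2 hxa,
    fun y hy => c.mem_box.2 fun l => (ha' l).2 (c.mem_box.1 hy l)⟩

/-- Boxes of late columns around a point are small. -/
lemma exists_forall_ge_box_subset {U : Set (Fin k → c.space)} (hU : IsOpen U)
    {x : Fin k → c.space} (hx : x ∈ U) :
    ∃ N, ∀ n ≥ N, ∀ a, x ∈ c.box n a → c.box n a ⊆ U := by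
  obtain ⟨ε, hε, hεU⟩ := Metric.isOpen_iff.1 hU x hx
  obtain ⟨N, hN⟩ := Filter.eventually_atTop.1 (c.tendsto_levelWidth.eventually_lt_const hε)
  refine ⟨N, fun n hn a hxa y hy => hεU ?_⟩
  rw [Metric.mem_ball, dist_pi_lt_iff hε]
  intro l
  have h1 := c.mem_box.1 hxa l
  have h2 := c.mem_box.1 hy l
  have := hN n hn
  simp only [level, Set.mem_Ico] at h1 h2
  rw [Subtype.dist_eq, Real.dist_eq, abs_lt]
  constructor <;> linarith [h1.1, h1.2, h2.1, h2.2]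

/-- A set of positive measure fills a proportion as close to one as desired of some box. -/
lemma exists_box_measure_inter_gt {A : Set (Fin k → c.space)}
    (hA0 : c.productMeasure k A ≠ 0) {θ : ENNReal} (hθ : θ < 1) :
    ∃ n, ∃ a : Fin k → ℕ, (∀ l, a l < c.height n) ∧
      θ * c.productMeasure k (c.box n a) < c.productMeasure k (A ∩ c.box n a) := by
  set μ := c.productMeasure k with hμ
  by_contra! hcon
  -- reduce to a subset `B` of `A` inside one box
  obtain ⟨n₀, a₀, ha₀, hpos⟩ : ∃ n, ∃ a : Fin k → ℕ, (∀ l, a l < c.height n) ∧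
      μ (A ∩ c.box n a) ≠ 0 := by
    by_contra! hz
    refine hA0 (measure_mono_null (t := ⋃ n, ⋃ a : Fin k → ℕ, ⋃ _ : ∀ l, a l < c.height n,
      A ∩ c.box n a) (fun x hx => ?_) ?_)
    · obtain ⟨N, hN⟩ := c.exists_forall_ge_mem_box x
      obtain ⟨a, ha, hxa⟩ := hN N le_rfl
      simp only [Set.mem_iUnion]
      exact ⟨N, a, ha, hx, hxa⟩
    · simp only [measure_iUnion_null_iff]
      exact hz
  set W := c.box n₀ a₀ with hW
  have hWfin : μ W ≠ ⊤ := by rw [c.measure_box ha₀]; exact ENNReal.ofReal_ne_top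
  -- Finiteness provides outer regularity, used below to find `U`.
  have : IsFiniteMeasure (μ.restrict W) := ⟨by simpa using hWfin.lt_top⟩
  have hBfin : μ (A ∩ W) ≠ ⊤ := measure_ne_top_of_subset Set.inter_subset_right hWfin
  -- Room for an open set slightly larger than `A ∩ W` whose measure times `θ` is still below that
  -- of `A ∩ W`.
  obtain ⟨q, hq, hq'⟩ : ∃ q, μ (A ∩ W) < q ∧ θ * q < μ (A ∩ W) := by
    have hne : θ ≠ ⊤ := hθ.ne_top
    have hcont : Filter.Tendsto (fun q => θ * q) (nhdsWithin (μ (A ∩ W)) (Set.Ioi (μ (A ∩ W))))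
        (nhds (θ * μ (A ∩ W))) :=
      ((ENNReal.continuous_const_mul hne).tendsto _).mono_left nhdsWithin_le_nhds
    have hlt : θ * μ (A ∩ W) < μ (A ∩ W) := by
      conv_rhs => rw [← one_mul (μ (A ∩ W))]
      exact ENNReal.mul_lt_mul_left hpos hBfin hθ
    have hbot : (nhdsWithin (μ (A ∩ W)) (Set.Ioi (μ (A ∩ W)))).NeBot :=
      nhdsGT_neBot_of_exists_gt ⟨⊤, hBfin.lt_top⟩
    obtain ⟨q, h1, h2⟩ := ((hcont.eventually_lt_const hlt).and self_mem_nhdsWithin).exists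
    exact ⟨q, h2, h1⟩
  obtain ⟨U, hAU, hU, hUq⟩ := Set.exists_isOpen_lt_of_lt (μ := μ.restrict W) (A ∩ W) q
    (by rwa [Measure.restrict_eq_self _ Set.inter_subset_right])
  rw [Measure.restrict_apply hU.measurableSet] at hUq
  -- the part of `U ∩ W` covered by the boxes of the column `Cₙ` inside it
  let F : ℕ → Set (Fin k → ℕ) := fun n =>
    {a | (∀ l, a l < c.height n) ∧ c.box n a ⊆ U ∩ W}
  let V : ℕ → Set (Fin k → c.space) := fun n => ⋃ a ∈ F n, c.box n a
  have hVmono : Monotone V := monotone_nat_of_le_succ fun n x hx => by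
    obtain ⟨a, ha, hxa⟩ := Set.mem_iUnion₂.1 hx
    obtain ⟨a', ha', hxa', hsub⟩ := c.exists_box_subset ha.1 hxa
    exact Set.mem_iUnion₂.2 ⟨a', ⟨ha', hsub.trans ha.2⟩, hxa'⟩
  have hcover : A ∩ W ⊆ ⋃ n, A ∩ V n := fun x hx => by
    obtain ⟨N₁, h₁⟩ := c.exists_forall_ge_mem_box x
    obtain ⟨N₂, h₂⟩ := c.exists_forall_ge_box_subset hU (hAU hx)
    set n := max n₀ (max N₁ N₂) with hn
    obtain ⟨a, ha, hxa⟩ := h₁ n (by omega)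
    refine Set.mem_iUnion.2 ⟨n, hx.1, Set.mem_iUnion₂.2 ⟨a, ⟨ha, Set.subset_inter
      (h₂ n (by omega) a hxa) fun y hy => ?_⟩, hxa⟩⟩
    refine c.mem_box.2 fun l => ?_
    exact (c.mem_descendants.1 (c.mem_descendants_of_mem (by omega) (ha₀ l) (ha l)
      (c.mem_box.1 hxa l) (c.mem_box.1 hx.2 l))).2 (c.mem_box.1 hy l)
  -- The boxes of one column are disjoint, so the assumed bound on each box adds up.
  have hbound : ∀ n, μ (A ∩ V n) ≤ θ * q := fun n => by
    have hcount : (F n).Countable := Set.to_countable _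
    calc μ (A ∩ V n) = μ (⋃ a ∈ F n, A ∩ c.box n a) := by
          simp only [V, Set.inter_iUnion₂]
      _ ≤ ∑' a : F n, μ (A ∩ c.box n a) := measure_biUnion_le _ hcount _
      _ ≤ ∑' a : F n, θ * μ (c.box n a) :=
          ENNReal.tsum_le_tsum fun a => hcon n a a.2.1
      _ = θ * μ (V n) := by
          rw [ENNReal.tsum_mul_left, measure_biUnion hcount]
          · intro a ha b hb hab
            exact Set.disjoint_left.2 fun x hxa hxb => hab (c.eq_of_mem_box ha.1 hb.1 hxa hxb)
          · exact fun a _ => c.measurableSet_box n a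
      _ ≤ θ * q := by
          gcongr
          exact (measure_mono (Set.iUnion₂_subset fun a ha => ha.2)).trans hUq.le
  refine absurd hq' (not_lt.2 ?_)
  calc μ (A ∩ W) ≤ μ (⋃ n, A ∩ V n) := measure_mono hcover
    _ = ⨆ n, μ (A ∩ V n) := Monotone.measure_iUnion
        fun m n hmn => Set.inter_subset_inter_right _ (hVmono hmn)
    _ ≤ θ * q := iSup_le hbound

/-! ### Action of products of powers on boxes. -/

variable {c} {T : c.space ≃ᵐ c.space}

lemma IsRankOneMap.measurePreserving_productOfPowers (hT : c.IsRankOneMap T) (a : Fin k → ℤ) :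
    MeasurePreserving (productOfPowers T a) (c.productMeasure k) (c.productMeasure k) :=
  measurePreserving_pi _ _ fun l => measurePreserving_zpow hT.measurePreserving (a l)

lemma IsRankOneMap.ae_productOfPowers_mem_box (hT : c.IsRankOneMap T) :
    ∀ᵐ x ∂c.productMeasure k, ∀ (n : ℕ) (a a' : Fin k → ℕ) (b : Fin k → ℤ),
      (∀ l, a l < c.height n) → (∀ l, a' l < c.height n) → (∀ l, (a' l : ℤ) = a l + b l) →
      x ∈ c.box n a → productOfPowers T b x ∈ c.box n a' := by
  have : ∀ᵐ x ∂c.productMeasure k, ∀ l : Fin k, ∀ (n a a' : ℕ),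
      a < c.height n → a' < c.height n → x l ∈ c.slice n a →
      ((T.toEquiv : Equiv.Perm c.space) ^ ((a' : ℤ) - a)) (x l) ∈ c.slice n a' := by
    rw [ae_all_iff]; intro l
    exact (Measure.quasiMeasurePreserving_eval (fun _ : Fin k => c.measure) l).ae
      hT.ae_zpow_mem_slice
  filter_upwards [this] with x hx n a a' b ha ha' hb hxa
  refine c.mem_box.2 fun l => ?_
  have h := hx l n (a l) (a' l) (ha l) (ha' l) (c.mem_box.1 hxa l)
  rwa [show (a' l : ℤ) - a l = b l by rw [hb]; ring] at h

lemma IsRankOneMap.preimage_box_ae_eq (hT : c.IsRankOneMap T) {n : ℕ} {a a' : Fin k → ℕ}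
    {b : Fin k → ℤ} (ha : ∀ l, a l < c.height n) (ha' : ∀ l, a' l < c.height n)
    (hb : ∀ l, (a' l : ℤ) = a l + b l) :
    (productOfPowers T b ⁻¹' c.box n a' : Set _) =ᵐ[c.productMeasure k] c.box n a := by
  have mp := hT.measurePreserving_productOfPowers b
  refine (ae_eq_of_ae_subset_of_measure_ge ?_ ?_
    (c.measurableSet_box n a).nullMeasurableSet ?_).symm
  · filter_upwards [hT.ae_productOfPowers_mem_box] with x hx hxa using hx n a a' b ha ha' hb hxa
  · rw [mp.measure_preimage (c.measurableSet_box _ _).nullMeasurableSet, c.measure_box ha',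
      c.measure_box ha]
  · rw [mp.measure_preimage (c.measurableSet_box _ _).nullMeasurableSet, c.measure_box ha']
    exact ENNReal.ofReal_ne_top

/-- The part of a set in a box, transported to another box of the same column. -/
lemma IsRankOneMap.measure_preimage_inter_box (hT : c.IsRankOneMap T) {n : ℕ} {a a' : Fin k → ℕ}
    {b : Fin k → ℤ} (ha : ∀ l, a l < c.height n) (ha' : ∀ l, a' l < c.height n)
    (hb : ∀ l, (a' l : ℤ) = a l + b l) {A : Set (Fin k → c.space)} (hA : MeasurableSet A) :
    c.productMeasure k (productOfPowers T b ⁻¹' A ∩ c.box n a) =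
      c.productMeasure k (A ∩ c.box n a') := by
  have mp := hT.measurePreserving_productOfPowers b
  rw [← mp.measure_preimage (hA.inter (c.measurableSet_box n a')).nullMeasurableSet,
    Set.preimage_inter]
  exact measure_congr ((ae_eq_refl _).inter (hT.preimage_box_ae_eq ha ha' hb).symm)

end CuttingAndStacking

/-! ### Complemented tuples imply conservativity. -/

namespace CuttingAndStacking

variable {c : CuttingAndStacking} {k : ℕ}

lemma mem_complementedTuples {α : Fin k → ℤ} (hα : ∀ l, α l ≠ 0) {i j : ℕ} {a : Fin k → ℕ} :
    a ∈ c.complementedTuples α i j ↔ a ∈ c.descendantTuples k i j ∧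
      ∃ d ∈ c.descendantTuples k i j, ∃ n : ℤ, n ≠ 0 ∧ ∀ l, (a l : ℤ) = d l + n * α l := by
  have h : ∀ (d : Fin k → ℕ) (n : ℤ) l, ((a l : ℚ) - (d l : ℚ)) / (α l : ℚ) = (n : ℚ) ↔
      (a l : ℤ) = d l + n * α l := fun d n l => by
    rw [div_eq_iff (by exact_mod_cast hα l), sub_eq_iff_eq_add']
    exact_mod_cast Iff.rfl
  simp only [complementedTuples, Set.mem_ofPred_eq, h]

variable (c) in
lemma card_descendantTuples_mul {i j : ℕ} (hij : i ≤ j) :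
    ((c.descendantTuples k i j).card : ℝ) * levelWidth c.r j ^ k = levelWidth c.r i ^ k := by
  rw [card_descendantTuples, Nat.cast_pow, ← mul_pow, c.card_descendants_mul hij (c.height_pos i)]

/-- If no two distinct tuples of `G` are complements of each other, then at least half of the
complemented tuples are outside `G`. -/
lemma ncard_complementedTuples_le {α : Fin k → ℤ} (hα : ∀ l, α l ≠ 0) {i j : ℕ}
    {G : Finset (Fin k → ℕ)} (hG : ∀ a ∈ G, ∀ d ∈ G, ∀ n : ℤ, n ≠ 0 →
      ¬ ∀ l, (a l : ℤ) = d l + n * α l) :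
    (c.complementedTuples α i j).ncard ≤ 2 * (c.descendantTuples k i j \ G).card := by
  classical
  set D := c.descendantTuples k i j with hD
  set C := D.filter (· ∈ c.complementedTuples α i j) with hC
  have hCset : c.complementedTuples α i j = C := by
    ext a
    simp only [hC, Finset.coe_filter, Set.mem_ofPred_eq]
    exact ⟨fun h => ⟨h.1, h⟩, fun h => h.2⟩
  have hex : ∀ a, ∃ d, a ∈ C → d ∈ D ∧ ∃ n : ℤ, n ≠ 0 ∧ ∀ l, (a l : ℤ) = d l + n * α l := fun a => by
    by_cases ha : a ∈ C
    · obtain ⟨_, d, hd, hn⟩ := (mem_complementedTuples hα).1 (Finset.mem_filter.1 ha).2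
      exact ⟨d, fun _ => ⟨hd, hn⟩⟩
    · exact ⟨a, fun h => absurd h ha⟩
  choose f hf using hex
  -- A choice of complements sends `C ∩ G` outside `G`. It is injective: two tuples of `G` with a
  -- common complement differ by a multiple of `α`, which must be zero.
  have h1 : (C.filter (· ∈ G)).card ≤ (D \ G).card := by
    refine Finset.card_le_card_of_injOn f (fun a ha => ?_) fun a ha a' ha' haa' => ?_
    · simp only [Finset.coe_filter, Set.mem_ofPred_eq] at ha
      obtain ⟨hd, n, hn, hl⟩ := hf a ha.1
      exact Finset.mem_coe.2 (Finset.mem_sdiff.2 ⟨hd, fun hdG => hG a ha.2 _ hdG n hn hl⟩)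
    · simp only [Finset.coe_filter, Set.mem_ofPred_eq] at ha ha'
      obtain ⟨_, n, hn, hl⟩ := hf a ha.1
      obtain ⟨_, n', hn', hl'⟩ := hf a' ha'.1
      have hdiff : ∀ l, (a l : ℤ) = a' l + (n - n') * α l := fun l => by
        rw [hl, hl', haa']; ring
      by_cases hnn : n - n' = 0
      · funext l
        have := hdiff l
        rw [hnn] at this
        exact_mod_cast (by simpa using this : (a l : ℤ) = a' l)
      · exact absurd hdiff (hG a ha.2 a' ha'.2 _ hnn)
  have h2 : (C.filter (· ∉ G)).card ≤ (D \ G).card := by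
    refine Finset.card_le_card fun a ha => ?_
    rw [Finset.mem_filter] at ha
    exact Finset.mem_sdiff.2 ⟨(Finset.mem_filter.1 ha.1).1, ha.2⟩
  rw [hCset, Set.ncard_coe_finset, ← Finset.card_filter_add_card_filter_not (· ∈ G)]
  omega

variable {T : c.space ≃ᵐ c.space}

theorem IsRankOneMap.conservative_of_complemented (hT : c.IsRankOneMap T) {α : Fin k → ℤ}
    (hα : ∀ l, α l ≠ 0)
    (h : ∀ i : ℕ, ∀ ε : ℝ, 0 < ε → ∃ j : ℕ, i ≤ j ∧
      (1 - ε) * ((c.descendants i 0 j).card : ℝ) ^ k ≤ ((c.complementedTuples α i j).ncard : ℝ)) :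
    Conservative (productOfPowers T α) (c.productMeasure k) := by
  refine ⟨(hT.measurePreserving_productOfPowers α).quasiMeasurePreserving, fun A hA hA0 => ?_⟩
  by_contra! hcon
  -- For negative exponents the point and its image exchange roles.
  have hwander : ∀ z : ℤ, z ≠ 0 → ∀ x ∈ A, productOfPowers T (z • α) x ∉ A :=
      fun z hz x hx hzx => by
    obtain ⟨m, rfl | rfl⟩ := z.eq_nat_or_neg
    · exact hcon x hx m (by simpa using hz) (by rwa [iterate_productOfPowers])
    · refine hcon _ hzx m (by simpa using hz) ?_
      rw [iterate_productOfPowers, ← productOfPowers_add, ← add_smul]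
      simpa [productOfPowers_zero] using hx
  obtain ⟨i, b, hb, hbA⟩ := c.exists_box_measure_inter_gt hA0
    (θ := ENNReal.ofReal (7 / 8)) (ENNReal.ofReal_lt_one.2 (by norm_num))
  set μ := c.productMeasure k with hμ
  -- The hypothesis concerns bases only, so the dense box is pulled back to the base box; `A'` still
  -- wanders because the two maps commute.
  set A' := productOfPowers T (fun l => (b l : ℤ)) ⁻¹' A with hA'
  have hA'm : MeasurableSet A' := (hT.measurePreserving_productOfPowers _).measurable hA
  have hwander' : ∀ z : ℤ, z ≠ 0 → ∀ x ∈ A', productOfPowers T (z • α) x ∉ A' :=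
    fun z hz x hx hzx => hwander z hz _ hx (by rwa [productOfPowers_comm])
  have hbase : 7 / 8 * levelWidth c.r i ^ k < μ.real (A' ∩ c.box i 0) := by
    rw [← hT.measure_preimage_inter_box (a := 0) (b := fun l => (b l : ℤ))
      (fun _ => c.height_pos i) hb (by simp) hA,
      c.measure_box hb, ← ENNReal.ofReal_mul (by norm_num)] at hbA
    refine (ENNReal.ofReal_lt_iff_lt_toReal ?_ ?_).1 hbA
    · have := c.levelWidth_pos i; positivity
    · refine measure_ne_top_of_subset Set.inter_subset_right ?_
      rw [c.measure_box (a := 0) fun _ => c.height_pos i]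
      exact ENNReal.ofReal_ne_top
  -- With `1 / 4`, at least `3 / 8` of the tuples fall outside `G`, so `A'` fills at most `1 - 3 /
  -- 16 = 13 / 16` of the base box, less than `7 / 8`.
  obtain ⟨j, hij, hj⟩ := h i (1 / 4) (by norm_num)
  set D := c.descendantTuples k i j with hD
  set w := levelWidth c.r j ^ k with hw
  have hw0 : 0 < w := pow_pos (c.levelWidth_pos j) k
  have hlt : ∀ a ∈ D, ∀ l, a l < c.height j := fun a ha => c.lt_height_of_mem_descendantTuples ha
  have hfin : ∀ a ∈ D, μ (c.box j a) ≠ ⊤ := fun a ha => by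
    rw [c.measure_box (hlt a ha)]; exact ENNReal.ofReal_ne_top
  -- the boxes filled by `A'` for more than a half
  classical
  set G := D.filter fun a => w / 2 < μ.real (A' ∩ c.box j a) with hG
  have hGD : G ⊆ D := Finset.filter_subset _ _
  -- Pulled back to the box of `d`, the part of `A'` in the box of `a` must avoid the part of `A'`
  -- already there, yet each exceeds half of the box.
  have hpair : ∀ a ∈ G, ∀ d ∈ G, ∀ n : ℤ, n ≠ 0 → ¬ ∀ l, (a l : ℤ) = d l + n * α l := by
    intro a ha d hd n hn hl
    have ha' := (Finset.mem_filter.1 ha).2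
    have hd' := (Finset.mem_filter.1 hd).2
    have hda := hlt a (hGD ha)
    have hdd := hlt d (hGD hd)
    have hmove : μ.real (productOfPowers T (n • α) ⁻¹' A' ∩ c.box j d) = μ.real (A' ∩ c.box j a) :=
      congrArg ENNReal.toReal (hT.measure_preimage_inter_box hdd hda (by simpa using hl) hA'm)
    have hdisj : Disjoint (productOfPowers T (n • α) ⁻¹' A' ∩ c.box j d) (A' ∩ c.box j d) :=
      Set.disjoint_left.2 fun x hx hx' => hwander' n hn x hx'.1 hx.1
    have hun := measureReal_union hdisj (hA'm.inter (c.measurableSet_box j d))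
      (μ := μ) (measure_ne_top_of_subset Set.inter_subset_right (hfin d (hGD hd)))
      (measure_ne_top_of_subset Set.inter_subset_right (hfin d (hGD hd)))
    have hle : μ.real (productOfPowers T (n • α) ⁻¹' A' ∩ c.box j d ∪ A' ∩ c.box j d) ≤ w := by
      rw [hw, ← c.measureReal_box hdd]
      exact measureReal_mono (Set.union_subset Set.inter_subset_right Set.inter_subset_right)
        (hfin d (hGD hd))
    linarith
  have hcount := ncard_complementedTuples_le (c := c) (i := i) (j := j) hα hpair
  have hsum : μ.real (A' ∩ c.box i 0) ≤ ∑ a ∈ D, μ.real (A' ∩ c.box j a) := by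
    refine (measureReal_mono ?_ ?_).trans (measureReal_biUnion_finset_le D _)
    · rw [← Set.inter_iUnion₂]
      exact Set.inter_subset_inter_right _ (c.box_zero_subset_iUnion hij)
    · exact ((measure_biUnion_lt_top D.finite_toSet fun a ha => (measure_ne_top_of_subset
        Set.inter_subset_right (hfin a ha)).lt_top)).ne
  have hsplit : ∑ a ∈ D, μ.real (A' ∩ c.box j a) ≤
      (G.card : ℝ) * w + ((D \ G).card : ℝ) * (w / 2) := by
    rw [← Finset.sum_sdiff hGD, add_comm]
    refine add_le_add ?_ ?_
    · rw [← nsmul_eq_mul]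
      refine Finset.sum_le_card_nsmul _ _ _ fun a ha => ?_
      rw [hw, ← c.measureReal_box (hlt a (hGD ha))]
      exact measureReal_mono Set.inter_subset_right (hfin a (hGD ha))
    · rw [← nsmul_eq_mul]
      refine Finset.sum_le_card_nsmul _ _ _ fun a ha => ?_
      rw [Finset.mem_sdiff, Finset.mem_filter] at ha
      exact not_lt.1 fun hlt => ha.2 ⟨ha.1, hlt⟩
  have hcard : ((D \ G).card : ℝ) + G.card = D.card := by
    exact_mod_cast Finset.card_sdiff_add_card_eq_card hGD
  have hDw : (D.card : ℝ) * w = levelWidth c.r i ^ k := c.card_descendantTuples_mul hij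
  have hj' : (1 - 1 / 4) * (D.card : ℝ) ≤ 2 * ((D \ G).card : ℝ) := by
    rw [← Nat.cast_pow, ← c.card_descendantTuples] at hj
    exact hj.trans (by exact_mod_cast hcount)
  nlinarith

/-! ### Conservativity implies complemented tuples. -/

/-- The tuples of descendants one of whose entries is within `H` of the ends of the column. -/
lemma card_filter_edge_mul_le (i j H : ℕ) :
    (((c.descendantTuples k i j).filter fun a => ∃ l, a l < H ∨ c.height j ≤ a l + H).card) *
      (c.descendants i 0 j).card ≤ k * (2 * H) * (c.descendants i 0 j).card ^ k := by
  classical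
  set D := c.descendants i 0 j with hD
  set E := D.filter fun a => a < H ∨ c.height j ≤ a + H with hE
  have hEcard : E.card ≤ 2 * H := by
    have hsub : E ⊆ Finset.range H ∪ Finset.Ico (c.height j - H) (c.height j) := fun a ha => by
      rw [hE, Finset.mem_filter, hD, mem_descendants] at ha
      simp only [Finset.mem_union, Finset.mem_range, Finset.mem_Ico]
      omega
    refine (Finset.card_le_card hsub).trans ((Finset.card_union_le _ _).trans ?_)
    rw [Finset.card_range, Nat.card_Ico]
    omega
  have hsub : ((c.descendantTuples k i j).filter fun a => ∃ l, a l < H ∨ c.height j ≤ a l + H) ⊆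
      Finset.univ.biUnion fun l : Fin k =>
        Fintype.piFinset (Function.update (fun _ : Fin k => D) l E) := fun a ha => by
    rw [Finset.mem_filter, mem_descendantTuples] at ha
    obtain ⟨ha, l, hl⟩ := ha
    refine Finset.mem_biUnion.2 ⟨l, Finset.mem_univ l, Fintype.mem_piFinset.2 fun m => ?_⟩
    by_cases hm : m = l
    · subst hm
      simpa [hE] using ⟨ha m, hl⟩
    · simpa [hm] using ha m
  have hcard : ∀ l : Fin k, (Fintype.piFinset (Function.update (fun _ : Fin k => D) l E)).card *
      D.card ≤ 2 * H * D.card ^ k := fun l => by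
    have h1 : (fun m => (Function.update (fun _ : Fin k => D) l E m).card) =
        Function.update (fun _ : Fin k => D.card) l E.card := by
      funext m
      by_cases hm : m = l
      · subst hm; simp
      · simp [hm]
    -- The index `l` shows `k ≥ 1`, so `k - 1` is not truncated.
    have h2 : ∏ m : Fin k, D.card = D.card * D.card ^ (k - 1) := by
      rw [← Finset.mul_prod_erase Finset.univ _ (Finset.mem_univ l)]
      simp
    rw [Finset.prod_const, Finset.card_univ, Fintype.card_fin] at h2
    rw [Fintype.card_piFinset, h1, Finset.prod_update_of_mem (Finset.mem_univ l),
      Finset.prod_const, Finset.card_sdiff_of_subset (Finset.subset_univ _), Finset.card_univ,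
      Fintype.card_fin, Finset.card_singleton, h2, mul_assoc, mul_comm (D.card ^ (k - 1))]
    exact Nat.mul_le_mul_right _ hEcard
  calc _ ≤ (∑ l : Fin k, (Fintype.piFinset (Function.update (fun _ : Fin k => D) l E)).card) *
        D.card := Nat.mul_le_mul_right _ ((Finset.card_le_card hsub).trans Finset.card_biUnion_le)
    _ ≤ ∑ l : Fin k, 2 * H * D.card ^ k := by
        rw [Finset.sum_mul]; exact Finset.sum_le_sum fun l _ => hcard l
    _ = k * (2 * H) * D.card ^ k := by simp [mul_assoc]

theorem IsRankOneMap.exists_complemented_of_conservative (hT : c.IsRankOneMap T) {α : Fin k → ℤ}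
    (hα : ∀ l, α l ≠ 0) (h : Conservative (productOfPowers T α) (c.productMeasure k))
    (i : ℕ) {ε : ℝ} (hε : 0 < ε) : ∃ j : ℕ, i ≤ j ∧
      (1 - ε) * ((c.descendants i 0 j).card : ℝ) ^ k ≤
        ((c.complementedTuples α i j).ncard : ℝ) := by
  classical
  set μ := c.productMeasure k with hμ
  set W : Set (Fin k → c.space) := c.box i 0 with hW
  have hWm : MeasurableSet W := c.measurableSet_box i 0
  have hWr : μ W = ENNReal.ofReal (levelWidth c.r i ^ k) := c.measure_box fun _ => c.height_pos i
  have hWfin : μ W ≠ ⊤ := by rw [hWr]; exact ENNReal.ofReal_ne_top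
  have hwi : 0 < levelWidth c.r i ^ k := pow_pos (c.levelWidth_pos i) k
  -- the points that do not return up to time `M`
  let Z : ℕ → Set (Fin k → c.space) := fun M =>
    W ∩ ⋂ m ∈ Set.Icc 1 M, ((productOfPowers T α)^[m] ⁻¹' W)ᶜ
  have hZm : ∀ M, MeasurableSet (Z M) := fun M => hWm.inter <| MeasurableSet.biInter
    (Set.to_countable _) fun m _ =>
      (((hT.measurePreserving_productOfPowers α).measurable.iterate m) hWm).compl
  have hZanti : Antitone Z := fun M M' hM => Set.inter_subset_inter_right _
    (Set.biInter_subset_biInter_left (Set.Icc_subset_Icc_right hM))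
  -- Recurrence: almost every point of `W` returns at some positive time.
  have hZ0 : μ (⋂ M, Z M) = 0 := by
    have hret := h.ae_mem_imp_frequently_image_mem hWm.nullMeasurableSet
    rw [measure_eq_zero_iff_ae_notMem]
    filter_upwards [hret] with x hx hxZ
    have hxW : x ∈ W := (Set.mem_iInter.1 hxZ 0).1
    obtain ⟨m, hm, hmW⟩ := Filter.frequently_atTop.1 (hx hxW) 1
    exact Set.mem_iInter₂.1 (Set.mem_iInter.1 hxZ m).2 m ⟨hm, le_rfl⟩ hmW
  obtain ⟨M, hM⟩ : ∃ M, μ (Z M) < ENNReal.ofReal (ε / 2 * levelWidth c.r i ^ k) := by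
    have hlim := tendsto_measure_iInter_atTop (μ := μ) (fun M => (hZm M).nullMeasurableSet)
      hZanti ⟨0, measure_ne_top_of_subset Set.inter_subset_left hWfin⟩
    rw [hZ0] at hlim
    exact (hlim.eventually_lt_const (ENNReal.ofReal_pos.2 (by positivity))).exists
  have hMr : μ.real (Z M) ≤ ε / 2 * levelWidth c.r i ^ k :=
    ENNReal.toReal_le_of_le_ofReal (by positivity) hM.le
  -- Bounds the displacement in every coordinate during `M` steps.
  set H : ℕ := M * ∑ l, (α l).natAbs with hH
  -- At most `2 * k * H` times `levelWidth c.r j / levelWidth c.r i` of the tuples are near the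
  -- ends; the factor `4` makes this `ε / 2`.
  obtain ⟨j, hij, hj⟩ : ∃ j, i ≤ j ∧
      4 * k * H * levelWidth c.r j ≤ ε * levelWidth c.r i := by
    have hlim := c.tendsto_levelWidth.const_mul (4 * k * H : ℝ)
    rw [mul_zero] at hlim
    obtain ⟨j, h1, h2⟩ := ((hlim.eventually_lt_const
      (mul_pos hε (c.levelWidth_pos i))).and (Filter.eventually_ge_atTop i)).exists
    exact ⟨j, h2, h1.le⟩
  refine ⟨j, hij, ?_⟩
  set D := c.descendantTuples k i j with hD
  set C := c.complementedTuples α i j with hC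
  set E := D.filter fun a => ∃ l, a l < H ∨ c.height j ≤ a l + H with hE
  set F := D.filter fun a => a ∉ C ∧ a ∉ E with hF
  have hlt : ∀ a ∈ D, ∀ l, a l < c.height j := fun a ha => c.lt_height_of_mem_descendantTuples ha
  -- a tuple that is neither complemented nor close to the ends gives points that do not return
  have hFZ : ∀ a ∈ F, c.box j a ≤ᵐ[μ] Z M := fun a ha => by
    obtain ⟨haD, haC, haE⟩ := Finset.mem_filter.1 ha
    filter_upwards [hT.ae_productOfPowers_mem_box] with x hx hxa
    refine ⟨c.box_subset_of_mem_descendantTuples haD hxa, Set.mem_iInter₂.2 fun m hm hmW => haC ?_⟩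
    rw [Set.mem_preimage, iterate_productOfPowers] at hmW
    have hbd : ∀ l, |(m : ℤ) * α l| ≤ H := fun l => by
      have h1 : (α l).natAbs ≤ ∑ l, (α l).natAbs :=
        Finset.single_le_sum (f := fun l => (α l).natAbs) (fun _ _ => Nat.zero_le _)
          (Finset.mem_univ l)
      rw [abs_mul, Nat.abs_cast, Int.abs_eq_natAbs, hH]
      exact_mod_cast Nat.mul_le_mul hm.2 h1
    have hin : ∀ l, 0 ≤ (a l : ℤ) + m * α l ∧ (a l : ℤ) + m * α l < c.height j := fun l => by
      have h1 : ¬ (a l < H ∨ c.height j ≤ a l + H) := fun hl =>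
        haE (Finset.mem_filter.2 ⟨haD, l, hl⟩)
      have h2 := abs_le.1 (hbd l)
      push Not at h1
      omega
    set d : Fin k → ℕ := fun l => ((a l : ℤ) + m * α l).toNat with hd
    have hdl : ∀ l, (d l : ℤ) = a l + m * α l := fun l => Int.toNat_of_nonneg (hin l).1
    have hdlt : ∀ l, d l < c.height j := fun l => by
      have := (hin l).2
      rw [← hdl] at this
      exact_mod_cast this
    have hxd := hx j a d ((m : ℤ) • α) (hlt a haD) hdlt (by simpa using hdl) hxa
    -- The image point lies both in the box of `d` and in `W`, so nesting makes `d` a tuple of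
    -- descendants.
    have hdD : d ∈ D := c.mem_descendantTuples.2 fun l =>
      c.mem_descendants_of_mem hij (c.height_pos i) (hdlt l) (c.mem_box.1 hxd l)
        (c.mem_box.1 hmW l)
    refine (mem_complementedTuples hα).2 ⟨haD, d, hdD, -m, ?_, fun l => by rw [hdl]; ring⟩
    have := hm.1
    omega
  have hFcard : (F.card : ℝ) * levelWidth c.r j ^ k ≤ ε / 2 * levelWidth c.r i ^ k := by
    have hFD : ∀ a ∈ F, a ∈ D := fun a ha => (Finset.mem_filter.1 ha).1
    have hun : μ.real (⋃ a ∈ F, c.box j a) = F.card * levelWidth c.r j ^ k := by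
      rw [measureReal_biUnion_finset (hm := fun a _ => c.measurableSet_box j a)
        (h := fun a ha => by rw [c.measure_box (hlt a (hFD a ha))]; exact ENNReal.ofReal_ne_top)]
      · rw [← nsmul_eq_mul]
        exact Finset.sum_eq_card_nsmul fun a ha => c.measureReal_box (hlt a (hFD a ha))
      · intro a ha b hb hab
        exact Set.disjoint_left.2 fun x hxa hxb =>
          hab (c.eq_of_mem_box (hlt a (hFD a ha)) (hlt b (hFD b hb)) hxa hxb)
    rw [← hun]
    refine le_trans (ENNReal.toReal_mono ?_ (measure_mono_ae ?_)) hMr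
    · exact measure_ne_top_of_subset Set.inter_subset_left hWfin
    · have : ∀ᵐ x ∂μ, ∀ a ∈ F, x ∈ c.box j a → x ∈ Z M :=
        (Filter.eventually_all_finset F).2 hFZ
      filter_upwards [this] with x hx hxU
      obtain ⟨a, ha, hxa⟩ := Set.mem_iUnion₂.1 hxU
      exact hx a ha hxa
  have hwj := c.levelWidth_pos j
  have hEcard : (E.card : ℝ) ≤ ε / 2 * D.card := by
    have h1 : ((E.card : ℝ)) * (c.descendants i 0 j).card ≤ k * (2 * H) * D.card := by
      rw [hD, card_descendantTuples]
      exact_mod_cast card_filter_edge_mul_le (c := c) (k := k) i j H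
    have h2 := c.card_descendants_mul hij (c.height_pos i)
    have h3 : (E.card : ℝ) * levelWidth c.r i ≤ ε / 2 * D.card * levelWidth c.r i := by
      calc (E.card : ℝ) * levelWidth c.r i
          = E.card * (c.descendants i 0 j).card * levelWidth c.r j := by rw [← h2]; ring
        _ ≤ k * (2 * H) * D.card * levelWidth c.r j := by gcongr
        _ = D.card * (4 * k * H * levelWidth c.r j) / 2 := by ring
        _ ≤ D.card * (ε * levelWidth c.r i) / 2 := by gcongr
        _ = ε / 2 * D.card * levelWidth c.r i := by ring
    exact le_of_mul_le_mul_right h3 (c.levelWidth_pos i)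
  have hFcard' : (F.card : ℝ) ≤ ε / 2 * D.card := by
    rw [← c.card_descendantTuples_mul hij, ← mul_assoc] at hFcard
    exact le_of_mul_le_mul_right hFcard (pow_pos hwj k)
  -- The tuples near the ends and those of non-returning boxes each cost at most `ε / 2`; all others
  -- are complemented.
  have hcover : D.card ≤ C.ncard + E.card + F.card := by
    have hCset : C = ↑(D.filter (· ∈ C)) := by
      ext a
      simp only [Finset.coe_filter, Set.mem_ofPred_eq]
      exact ⟨fun h => ⟨h.1, h⟩, fun h => h.2⟩
    have hsub : D ⊆ D.filter (· ∈ C) ∪ E ∪ F := fun a ha => by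
      simp only [Finset.mem_union, hF, Finset.mem_filter]
      tauto
    have := (Finset.card_le_card hsub).trans ((Finset.card_union_le _ _).trans
      (Nat.add_le_add_right (Finset.card_union_le _ _) _))
    rwa [← Set.ncard_coe_finset (D.filter (· ∈ C)), ← hCset] at this
  have hcover' : (D.card : ℝ) ≤ C.ncard + E.card + F.card := by exact_mod_cast hcover
  rw [← Nat.cast_pow, ← c.card_descendantTuples (k := k)]
  linarith

end CuttingAndStacking

end RankOne

theorem propositionL (c : RankOne.CuttingAndStacking) (T : c.space ≃ᵐ c.space)
    (hT : c.IsRankOneMap T) (k : ℕ) (α : Fin k → ℤ) (hα : ∀ l, α l ≠ 0) :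
    Conservative (RankOne.productOfPowers T α) (Measure.pi fun _ : Fin k => c.measure) ↔
      ∀ i : ℕ, ∀ ε : ℝ, 0 < ε → ∃ j : ℕ, i ≤ j ∧
        (1 - ε) * ((c.descendants i 0 j).card : ℝ) ^ k ≤
          ((c.complementedTuples α i j).ncard : ℝ) :=
  ⟨fun h i _ hε => hT.exists_complemented_of_conservative hα h i hε,
    hT.conservative_of_complemented hα⟩
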